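/- Let $\lambda\in(0,1/3)$. Let $v_1=(0,0)$, $v_2=(1,0)$, $v_3=(\tfrac12,\tfrac{\sqrt3}{2})$, let $A\subset\mathbb R^2$ be the closed triangle with these vertices, and let $s_i(p)=\lambda p+(1-\lambda)v_i$ for $i\in\{1,2,3\}$. For a word $\alpha=(i_1,\dots,i_n)\in\{1,2,3\}^n$ put $S_\alpha=s_{i_1}\circ\cdots\circ s_{i_n}(A)$ ($S_\alpha=A$ for the empty word), and let $$E_\lambda=\bigcap_{j\ge 0}\ \bigcup_{\alpha\in\{1,2,3\}^j}S_\alpha,\qquad d_\lambda=-\frac{\log 3}{\log\lambda}\in(0,1),\qquad \mu_\lambda=\mathcal H^{d_\lambda}\lfloor E_\lambda ,$$ where $\mathcal H^{d}$ is the $d$-dimensional Hausdorff measure. For $x\ne y$ in $\mathbb R^2$ let $\theta_{(x,y)}$ be the polar angle of $y-x$ modulo $2\pi$, and for $\varepsilon>0$ and $k\in\{0,\dots,5\}$ let $J_k=(\tfrac{k\pi}{3}-\varepsilon,\tfrac{k\pi}{3}+\varepsilon)$; membership of an angle in $J_k$ is understood modulo $2\pi$. Let $\varepsilon_\lambda>0$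 be a number such that, with $\varepsilon=\varepsilon_\lambda$: 1. for all $x\neq y$ in $E_\lambda$, $\theta_{(x,y)}\in J_k$ for some $k\in\{0,\dots,5\}$; 2. the intervals $J_0,\dots,J_5$ are pairwise disjoint; 3. whenever $n\ge1$ and $\alpha,\beta,\gamma\in\{1,2,3\}^n$ are pairwise distinct words with the same first $n-1$ letters: (a) if $x\in S_\alpha$, $y\in S_\beta$, $z\in S_\gamma$ and $\theta_{(x,y)}\in J_k$, then $\theta_{(x,z)}\in J_m$ for $m\equiv k+1$ or $m\equiv k-1 \pmod 6$; (b) if $x,z\in S_\alpha$, $y\in S_\beta$ and $\theta_{(x,y)}\in J_k$, then $\theta_{(z,y)}\in J_k$. Let $\Omega_\lambda:S^1\to\mathbb R$ be a $C^\infty$ function with $\Omega_\lambda(-z)=-\Omega_\lambda(z)$ for all $z\in S^1$ and $\Omega_\lambda(z)=(-1)^k$ whenever $\theta_{(z,0)}\in J_k$, $k\in\{0,\dots,5\}$. Let $h_\lambda:(0,\infty)\to\mathbb R$ be a $C^\infty$ nondecreasing function with $h_\lambda(r)=\lambda^{(k-1)d_\lambda}$ for all $r\in[(\tfrac1\lambda-2)\lambda^k,\lambda^{k-1}]$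 and all integers $k\ge1$. Put $$K_\lambda(x,y)=\frac{\Omega_\lambda\big((x-y)/|x-y|\big)}{h_\lambda(|x-y|)}\qquad(x\ne y),$$ $$T^*_\lambda f(x)=\sup_{r>0}\left|\int_{|x-y|>r}K_\lambda(x,y)f(y)\,d\mu_\lambda(y)\right| .$$ Then the maximal operator $T^*_\lambda$ is bounded in $L^2(\mu_\lambda)$: there is a constant $C<\infty$ such that for every real-valued $f\in L^2(\mu_\lambda)$ the integrals defining $T^*_\lambda f(x)$ converge absolutely for all $x\in E_\lambda$ and $r>0$, the function $T^*_\lambda f$ is $\mu_\lambda$-measurable, and $$\int (T^*_\lambda f)^2\,d\mu_\lambda\le C\int|f|^2\,d\mu_\lambda .$$ -/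

import Mathlib

open MeasureTheory Set
open scoped ENNReal Manifold ContDiff

noncomputable section

namespace SierpinskiGasket

/-- The Euclidean plane. -/
abbrev Plane : Type := EuclideanSpace ℝ (Fin 2)

instance factFinrankPlane : Fact (Module.finrank ℝ Plane = 1 + 1) :=
  ⟨by simp⟩

/-- The vertices `(0,0)`, `(1,0)`, `(1/2, √3/2)` of the unit equilateral triangle. -/
def vertex : Fin 3 → Plane :=
  ![!₂[0, 0], !₂[1, 0], !₂[1 / 2, Real.sqrt 3 / 2]]

/-- The closed (filled) equilateral triangle `A`. -/
def baseTriangle : Set Plane := convexHull ℝ (range vertex)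

/-- The three similitudes `s_i(p) = lam p + (1 - lam) v_i`. -/
def sim (lam : ℝ) (i : Fin 3) (p : Plane) : Plane :=
  lam • p + (1 - lam) • vertex i

/-- For a word `(i₁, …, iₙ)`, the composition `s_{i₁} ∘ ⋯ ∘ s_{iₙ}`;
the identity for the empty word. -/
def wordMap (lam : ℝ) : List (Fin 3) → Plane → Plane
  | [] => id
  | i :: w => sim lam i ∘ wordMap lam w

/-- The triangle `S_w = s_w(A)`. -/
def triangle (lam : ℝ) (w : List (Fin 3)) : Set Plane :=
  wordMap lam w '' baseTriangle

/-- The gasket: the intersection over `j` of the union of the triangles of generation `j`. -/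
def gasket (lam : ℝ) : Set Plane :=
  ⋂ j : ℕ, ⋃ w ∈ {w : List (Fin 3) | w.length = j}, triangle lam w

/-- The dimension `d = -log 3 / log lam`. -/
def dim (lam : ℝ) : ℝ := -Real.log 3 / Real.log lam

/-- The natural measure: `d`-dimensional Hausdorff measure restricted to the gasket. -/
def gasketMeasure (lam : ℝ) : Measure Plane :=
  (Measure.hausdorffMeasure (dim lam)).restrict (gasket lam)

/-- The open interval of angles of half-width `e` about `k π / 3`. -/
def angleInterval (e : ℝ) (k : Fin 6) : Set ℝ :=
  Ioo ((k : ℕ) * Real.pi / 3 - e) ((k : ℕ) * Real.pi / 3 + e)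

/-- The nonzero vectors whose polar angle lies, modulo `2π`, in `angleInterval e k`. -/
def sector (e : ℝ) (k : Fin 6) : Set Plane :=
  {v | v ≠ 0 ∧ ∃ t ∈ angleInterval e k, v = ‖v‖ • !₂[Real.cos t, Real.sin t]}

/-- The requirements on the angle `e = ε_lam`. The angle `θ_(x,y)` is that of `y - x`.
Words of equal length that agree up to their last letter are written `w ++ [i]`, `w ++ [j]`, …;
addition in `Fin 6` is modulo `6`. -/
structure IsAdmissibleAngle (lam e : ℝ) : Prop where
  pos : 0 < e
  cover : ∀ x ∈ gasket lam, ∀ y ∈ gasket lam, x ≠ y → ∃ k : Fin 6, y - x ∈ sector e k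
  disjoint : ∀ k m : Fin 6, k ≠ m → Disjoint (angleInterval e k) (angleInterval e m)
  adjacent : ∀ (w : List (Fin 3)) (i j l : Fin 3), i ≠ j → j ≠ l → i ≠ l →
    ∀ x ∈ triangle lam (w ++ [i]), ∀ y ∈ triangle lam (w ++ [j]),
    ∀ z ∈ triangle lam (w ++ [l]), ∀ k : Fin 6, y - x ∈ sector e k →
      z - x ∈ sector e (k + 1) ∨ z - x ∈ sector e (k - 1)
  same : ∀ (w : List (Fin 3)) (i j : Fin 3), i ≠ j →
    ∀ x ∈ triangle lam (w ++ [i]), ∀ z ∈ triangle lam (w ++ [i]),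
    ∀ y ∈ triangle lam (w ++ [j]), ∀ k : Fin 6, y - x ∈ sector e k → y - z ∈ sector e k

/-- The requirements on the angular part `Ω`, a function on the unit circle
(its values elsewhere are irrelevant). -/
structure IsAngularPart (e : ℝ) (Om : Plane → ℝ) : Prop where
  smooth : ContMDiff (𝓡 1) 𝓘(ℝ, ℝ) ∞ (fun z : Metric.sphere (0 : Plane) 1 => Om z)
  sign : ∀ z ∈ Metric.sphere (0 : Plane) 1, ∀ k : Fin 6,
    0 - z ∈ sector e k → Om z = (-1) ^ (k : ℕ)
  odd : ∀ z ∈ Metric.sphere (0 : Plane) 1, Om (-z) = -Om z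

/-- The requirements on the radial part `h`, a function on `(0, ∞)`
(its values elsewhere are irrelevant). -/
structure IsRadialPart (lam : ℝ) (h : ℝ → ℝ) : Prop where
  smooth : ContDiffOn ℝ ∞ h (Ioi 0)
  mono : MonotoneOn h (Ioi 0)
  plateau : ∀ k : ℕ, 1 ≤ k → ∀ r ∈ Icc ((1 / lam - 2) * lam ^ k) (lam ^ (k - 1)),
    h r = lam ^ (((k : ℝ) - 1) * dim lam)

/-- The kernel `K(x,y) = Ω((x-y)/|x-y|) / h(|x-y|)`, `x ≠ y`. -/
def kernel (Om : Plane → ℝ) (h : ℝ → ℝ) (x y : Plane) : ℝ :=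
  Om (‖x - y‖⁻¹ • (x - y)) / h ‖x - y‖

/-- The truncated operator `T_r f (x) = ∫_{|x-y| > r} K(x,y) f(y) dμ(y)`. -/
def truncated (lam : ℝ) (Om : Plane → ℝ) (h : ℝ → ℝ) (r : ℝ) (f : Plane → ℝ) (x : Plane) : ℝ :=
  ∫ y in {y | r < ‖x - y‖}, kernel Om h x y * f y ∂(gasketMeasure lam)

/-- The maximal operator `T^* f (x) = sup_{r > 0} |T_r f (x)|`, with values in `[0, ∞]`. -/
def maximal (lam : ℝ) (Om : Plane → ℝ) (h : ℝ → ℝ) (f : Plane → ℝ) (x : Plane) : ℝ≥0∞ :=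
  ⨆ (r : ℝ) (_ : 0 < r), ENNReal.ofReal |truncated lam Om h r f x|

end SierpinskiGasket

end

/-!
Two points `x`, `y` of the gasket that lie in distinct children `S_{wi}`, `S_{wj}` of the same
triangle `S_w` are at a distance where `h` is constant, equal to `3 ^ (-|w|)`. Conditions (3a) and
(3b) on the angle, with the oddness of `Ω`, force the sign of `K(x, y)` to depend only on `w`, `i`
and `j`, and to be of the form `s_w χ(j - i)` with `s_w = ±1`, `χ(1) = 1`, `χ(2) = -1`
(`exists_sign`). Hence, writing `b(w) = 3 ^ |w| ∫_{S_w} f dμ` (`density`), the integral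
`T(w) = ∫_{E \ S_w} K(x, y) f(y) dμ(y)` is the same for all `x ∈ E ∩ S_w` and satisfies
`T(wi) = T(w) + s_w / 3 * (b(w(i+1)) - b(w(i+2)))` (`outerIntegral_append`).

Thus `T` is a martingale on the ternary tree of words. It is a martingale transform of `b`, whose
increments are `1 / √3` times those of `b` up to rotation and sign, so it is bounded in `L²` by `b`
(`sum_transform_sq_le`), and `b` is bounded in `L²` by `f`, since `μ(S_w) = 3 ^ (-|w|) μ(E)` with
`μ(E) ≤ 1`.

Because `lam < 1 / 3`, points of `E` outside `S_w` are farther from `S_w` than its diameter. So a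
truncation at an arbitrary radius differs from some `T(w)`, `x ∈ S_w`, by at most
`3 ^ (|w| + 1) ∫_{S_w} |f| dμ` (`exists_abs_truncated_le`), and the maximal function is dominated by
that of the nonnegative submartingale `|T(w)| + 3 ^ (|w| + 1) ∫_{S_w} |f| dμ`. Doob's inequality
(`sum_prefixMax_sq_le`), a finite computation on each level of the tree, gives the bound.
-/

open MeasureTheory Set
open scoped ENNReal Manifold ContDiff

noncomputable section

namespace SierpinskiGasket

variable {lam e : ℝ} {Om : Plane → ℝ} {h : ℝ → ℝ} {f : Plane → ℝ} {B : Set Plane} {x : Plane}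
  {n : ℕ}

/-! ### Martingales on the ternary tree -/

lemma append_singleton_injective :
    Function.Injective fun p : List (Fin 3) × Fin 3 => p.1 ++ [p.2] := by
  rintro ⟨v, i⟩ ⟨w, j⟩ h
  simpa using h

/-- The words of length `n` over `{0, 1, 2}`, that is, the `n`-th level of the ternary tree in
which the children of `w` are the words `w ++ [i]`. -/
def words : ℕ → Finset (List (Fin 3))
  | 0 => {[]}
  | n + 1 => (words n ×ˢ Finset.univ).map ⟨_, append_singleton_injective⟩

lemma sum_words_succ {M : Type*} [AddCommMonoid M] (n : ℕ) (F : List (Fin 3) → M) :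
    ∑ w ∈ words (n + 1), F w = ∑ w ∈ words n, ∑ i, F (w ++ [i]) := by
  simp [words, Finset.sum_map, Finset.sum_product]

lemma mem_words {n : ℕ} {w : List (Fin 3)} : w ∈ words n ↔ w.length = n := by
  induction n generalizing w with
  | zero => simp [words]
  | succ n ih =>
    simp only [words, Finset.mem_map, Finset.mem_product, Finset.mem_univ, and_true,
      Function.Embedding.coeFn_mk, Prod.exists, ih]
    constructor
    · rintro ⟨v, i, rfl, rfl⟩
      simp
    · intro h
      obtain rfl | ⟨v, i, rfl⟩ := List.eq_nil_or_concat w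
      · simp at h
      · exact ⟨v, i, by simpa using h, by simp⟩

lemma card_words (n : ℕ) : (words n).card = 3 ^ n := by
  induction n with
  | zero => simp [words]
  | succ n ih => simp [words, ih, pow_succ]

/-- The maximum of `F` over the prefixes of `w`, including `w` itself: the maximal function of a
process on the ternary tree. -/
def prefixMax (F : List (Fin 3) → ℝ) (w : List (Fin 3)) : ℝ :=
  partialSups (fun k => F (w.take k)) w.length

lemma prefixMax_nil (F : List (Fin 3) → ℝ) : prefixMax F [] = F [] := by
  simp [prefixMax]

lemma prefixMax_append (F : List (Fin 3) → ℝ) (w : List (Fin 3)) (i : Fin 3) :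
    prefixMax F (w ++ [i]) = max (prefixMax F w) (F (w ++ [i])) := by
  unfold prefixMax
  rw [List.length_append, List.length_singleton, partialSups_add_one]
  congr 1
  · simp only [partialSups_apply]
    refine Finset.sup'_congr _ rfl fun k hk => ?_
    rw [List.take_append_of_le_length (by simpa using hk)]
  · rw [List.take_of_length_le (by simp)]

lemma le_prefixMax (F : List (Fin 3) → ℝ) (w : List (Fin 3)) : F w ≤ prefixMax F w := by
  have := le_partialSups (fun k => F (w.take k)) w.length
  simpa [prefixMax] using this

/-- **Doob's `L²` inequality** on the ternary tree, for a nonnegative submartingale. -/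
lemma sum_prefixMax_sq_le (F : List (Fin 3) → ℝ) (h0 : ∀ w, 0 ≤ F w)
    (hF : ∀ w, 3 * F w ≤ ∑ i, F (w ++ [i])) (n : ℕ) :
    ∑ w ∈ words n, prefixMax F w ^ 2 ≤ 4 * ∑ w ∈ words n, F w ^ 2 := by
  set M := prefixMax F with hM
  -- The sum of `2MF - M²` over a level is nonnegative: where the maximum grows from `m` to `F`,
  -- `2MF - M²` is `F² ≥ 2mF - m²`, so it increases along the tree like the submartingale `2mF`.
  have key : 0 ≤ ∑ w ∈ words n, (2 * M w * F w - M w ^ 2) := by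
    induction n with
    | zero =>
      simp only [words, Finset.sum_singleton, hM, prefixMax_nil]
      nlinarith [sq_nonneg (F [])]
    | succ n ih =>
      rw [sum_words_succ]
      have step : ∀ w ∈ words n, 3 * (2 * M w * F w - M w ^ 2) ≤
          ∑ i, (2 * M (w ++ [i]) * F (w ++ [i]) - M (w ++ [i]) ^ 2) := by
        intro w _
        have h1 : ∀ i, 2 * M w * F (w ++ [i]) - M w ^ 2 ≤
            2 * M (w ++ [i]) * F (w ++ [i]) - M (w ++ [i]) ^ 2 := by
          intro i
          rw [hM, prefixMax_append]
          rcases le_total (prefixMax F w) (F (w ++ [i])) with h | h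
          · rw [max_eq_right h]
            nlinarith [sq_nonneg (F (w ++ [i]) - prefixMax F w)]
          · rw [max_eq_left h]
        have hMw : 0 ≤ M w := (h0 w).trans (le_prefixMax F w)
        refine le_trans ?_ (Finset.sum_le_sum fun i _ => h1 i)
        rw [Finset.sum_sub_distrib, ← Finset.mul_sum]
        simp only [Finset.sum_const, Finset.card_univ, Fintype.card_fin, nsmul_eq_mul]
        have := mul_le_mul_of_nonneg_left (hF w) hMw
        push_cast
        linarith
      refine le_trans ?_ (Finset.sum_le_sum step)
      rw [← Finset.mul_sum]
      positivity
  have h2 : ∀ w ∈ words n, M w ^ 2 + 2 * (2 * M w * F w - M w ^ 2) ≤ 4 * F w ^ 2 := by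
    intro w _
    nlinarith [sq_nonneg (M w - 2 * F w)]
  have h3 := Finset.sum_le_sum h2
  rw [Finset.sum_add_distrib, ← Finset.mul_sum, ← Finset.mul_sum] at h3
  linarith

/-- The `L²` bound for a martingale transform on the ternary tree: the increment of `T` at a
vertex is obtained from that of `b` by a rotation of the plane `x₀ + x₁ + x₂ = 0`, up to sign and
a factor `1 / √3`. -/
lemma sum_transform_sq_le (T b s : List (Fin 3) → ℝ) (hT0 : T [] = 0)
    (hb : ∀ w, ∑ i, b (w ++ [i]) = 3 * b w) (hs : ∀ w, s w ^ 2 = 1)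
    (hT : ∀ w i, T (w ++ [i]) = T w + s w / 3 * (b (w ++ [i + 1]) - b (w ++ [i + 2]))) (n : ℕ) :
    ∑ w ∈ words n, T w ^ 2 ≤ 1 / 3 * ∑ w ∈ words n, b w ^ 2 := by
  have key : ∑ w ∈ words n, (T w ^ 2 - 1 / 3 * b w ^ 2) ≤ 0 := by
    induction n with
    | zero =>
      simp only [words, Finset.sum_singleton, hT0]
      nlinarith [sq_nonneg (b [])]
    | succ n ih =>
      rw [sum_words_succ]
      have step : ∀ w ∈ words n, ∑ i, (T (w ++ [i]) ^ 2 - 1 / 3 * b (w ++ [i]) ^ 2) =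
          3 * (T w ^ 2 - 1 / 3 * b w ^ 2) := by
        intro w _
        have h1 := hb w
        simp only [hT, Fin.sum_univ_three] at h1 ⊢
        simp only [Fin.isValue, zero_add, show (1 : Fin 3) + 1 = 2 from rfl,
          show (1 : Fin 3) + 2 = 0 from rfl, show (2 : Fin 3) + 1 = 0 from rfl,
          show (2 : Fin 3) + 2 = 1 from rfl]
        have h2 : b w = (b (w ++ [0]) + b (w ++ [1]) + b (w ++ [2])) / 3 := by linarith
        rw [h2]
        linear_combination (1 / 9 * ((b (w ++ [1]) - b (w ++ [2])) ^ 2 +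
          (b (w ++ [2]) - b (w ++ [0])) ^ 2 + (b (w ++ [0]) - b (w ++ [1])) ^ 2)) * hs w
      rw [Finset.sum_congr rfl step, ← Finset.mul_sum]
      linarith
  rw [Finset.sum_sub_distrib, ← Finset.mul_sum] at key
  linarith

/-! ### Geometry of the triangles -/

lemma norm_vertex_sub {i j : Fin 3} (hij : i ≠ j) : ‖vertex i - vertex j‖ = 1 := by
  have h3 : Real.sqrt 3 ^ 2 = 3 := Real.sq_sqrt (by norm_num)
  rw [EuclideanSpace.norm_eq, Real.sqrt_eq_one, Fin.sum_univ_two]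
  fin_cases i <;> fin_cases j <;> first | exact absurd rfl hij | skip
  all_goals
    simp only [vertex, Real.norm_eq_abs, sq_abs]
    simp
    try nlinarith [h3]

lemma vertex_mem_baseTriangle (i : Fin 3) : vertex i ∈ baseTriangle :=
  subset_convexHull ℝ _ ⟨i, rfl⟩

lemma isCompact_baseTriangle : IsCompact baseTriangle :=
  (finite_range vertex).isCompact_convexHull ℝ

lemma norm_sub_le_one {p q : Plane} (hp : p ∈ baseTriangle) (hq : q ∈ baseTriangle) :
    ‖p - q‖ ≤ 1 := by
  obtain ⟨_, ⟨i, rfl⟩, _, ⟨j, rfl⟩, h⟩ := convexHull_exists_dist_ge2 hp hq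
  rw [dist_eq_norm, dist_eq_norm] at h
  refine h.trans ?_
  by_cases hij : i = j
  · simp [hij]
  · exact (norm_vertex_sub hij).le

lemma wordMap_append (v w : List (Fin 3)) (p : Plane) :
    wordMap lam (v ++ w) p = wordMap lam v (wordMap lam w p) := by
  induction v with
  | nil => rfl
  | cons i v ih => simp [wordMap, ih]

lemma wordMap_sub (w : List (Fin 3)) (p q : Plane) :
    wordMap lam w p - wordMap lam w q = lam ^ w.length • (p - q) := by
  induction w with
  | nil => simp [wordMap]
  | cons i w ih =>
    simp only [wordMap, Function.comp_apply, sim, add_sub_add_right_eq_sub, ← smul_sub, ih,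
      smul_smul, List.length_cons, pow_succ']

lemma wordMap_eq (w : List (Fin 3)) (p : Plane) :
    wordMap lam w p = lam ^ w.length • p + wordMap lam w 0 := by
  have := wordMap_sub (lam := lam) w p 0
  rw [sub_zero] at this
  rw [← this, sub_add_cancel]

lemma wordMap_injective (h0 : 0 < lam) (w : List (Fin 3)) :
    Function.Injective (wordMap lam w) := by
  intro p q hpq
  have := wordMap_sub (lam := lam) w p q
  rw [hpq, sub_self] at this
  have h := (smul_eq_zero.1 this.symm).resolve_left (pow_ne_zero _ h0.ne')
  exact sub_eq_zero.1 h

lemma isCompact_triangle (w : List (Fin 3)) : IsCompact (triangle lam w) := by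
  refine isCompact_baseTriangle.image ?_
  rw [funext (wordMap_eq (lam := lam) w)]
  fun_prop

lemma measurableSet_triangle (w : List (Fin 3)) : MeasurableSet (triangle lam w) :=
  (isCompact_triangle w).isClosed.measurableSet

lemma measurableSet_gasket : MeasurableSet (gasket lam) :=
  MeasurableSet.iInter fun _ => MeasurableSet.biUnion (to_countable _)
    fun w _ => measurableSet_triangle w

lemma triangle_append_subset (h0 : 0 < lam) (h1 : lam < 1) (v w : List (Fin 3)) :
    triangle lam (v ++ w) ⊆ triangle lam v := by
  have key : ∀ p ∈ baseTriangle, wordMap lam w p ∈ baseTriangle := by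
    intro p hp
    induction w with
    | nil => exact hp
    | cons i w ih =>
      exact convex_convexHull ℝ _ ih (vertex_mem_baseTriangle i) h0.le (by linarith) (by ring)
  rintro _ ⟨p, hp, rfl⟩
  exact ⟨_, key p hp, (wordMap_append v w p).symm⟩

lemma norm_sub_le_of_mem_triangle (h0 : 0 < lam) {w : List (Fin 3)} {x y : Plane}
    (hx : x ∈ triangle lam w) (hy : y ∈ triangle lam w) : ‖x - y‖ ≤ lam ^ w.length := by
  obtain ⟨p, hp, rfl⟩ := hx
  obtain ⟨q, hq, rfl⟩ := hy
  rw [wordMap_sub, norm_smul, Real.norm_of_nonneg (by positivity)]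
  exact mul_le_of_le_one_right (by positivity) (norm_sub_le_one hp hq)

lemma le_norm_sub_of_mem_siblings (h0 : 0 < lam) (h1 : lam < 1) {w : List (Fin 3)} {i j : Fin 3}
    (hij : i ≠ j) {x y : Plane} (hx : x ∈ triangle lam (w ++ [i]))
    (hy : y ∈ triangle lam (w ++ [j])) : (1 - 2 * lam) * lam ^ w.length ≤ ‖x - y‖ := by
  obtain ⟨p, hp, rfl⟩ := hx
  obtain ⟨q, hq, rfl⟩ := hy
  rw [wordMap_append, wordMap_append, wordMap_sub, norm_smul,
    Real.norm_of_nonneg (by positivity), mul_comm]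
  refine mul_le_mul_of_nonneg_left ?_ (by positivity)
  have e : wordMap lam [i] p - wordMap lam [j] q =
      (1 - lam) • (vertex i - vertex j) - lam • (q - p) := by
    simp only [wordMap, Function.comp_apply, id, sim]
    module
  rw [e]
  refine le_trans ?_ (norm_sub_norm_le _ _)
  rw [norm_smul, norm_smul, norm_vertex_sub hij, Real.norm_of_nonneg h0.le,
    Real.norm_of_nonneg (by linarith)]
  nlinarith [mul_le_of_le_one_right h0.le (norm_sub_le_one hq hp)]

lemma eq_of_mem_triangle (hlam : lam ∈ Ioo (0 : ℝ) (1 / 3)) {v w : List (Fin 3)}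
    (hvw : v.length = w.length) {x : Plane} (hv : x ∈ triangle lam v)
    (hw : x ∈ triangle lam w) : v = w := by
  have h0 := hlam.1
  have h1 : lam < 1 := by linarith [hlam.2]
  induction v using List.reverseRecOn generalizing w with
  | nil => exact (List.length_eq_zero_iff.1 hvw.symm).symm
  | append_singleton v i ih =>
    obtain rfl | ⟨w, j, rfl⟩ := List.eq_nil_or_concat' w
    · simp at hvw
    · obtain rfl := ih (by simpa using hvw) (triangle_append_subset h0 h1 _ _ hv)
        (triangle_append_subset h0 h1 _ _ hw)
      by_cases hij : i = j
      · rw [hij]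
      · have := le_norm_sub_of_mem_siblings h0 h1 hij hv hw
        rw [sub_self, norm_zero] at this
        have h2 : 0 < (1 - 2 * lam) * lam ^ v.length :=
          mul_pos (by linarith [hlam.2]) (pow_pos h0 _)
        linarith

lemma mem_gasket {x : Plane} :
    x ∈ gasket lam ↔ ∀ n : ℕ, ∃ w : List (Fin 3), w.length = n ∧ x ∈ triangle lam w := by
  simp [gasket]

lemma exists_mem_child (hlam : lam ∈ Ioo (0 : ℝ) (1 / 3)) {w : List (Fin 3)} {x : Plane}
    (hx : x ∈ gasket lam) (hw : x ∈ triangle lam w) : ∃ i, x ∈ triangle lam (w ++ [i]) := by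
  obtain ⟨u, hu, hxu⟩ := mem_gasket.1 hx (w.length + 1)
  obtain rfl | ⟨u, i, rfl⟩ := List.eq_nil_or_concat' u
  · simp at hu
  · obtain rfl := eq_of_mem_triangle hlam (by simpa using hu)
      (triangle_append_subset hlam.1 (by linarith [hlam.2]) _ _ hxu) hw
    exact ⟨i, hxu⟩

/-- Since `lam < 1 / 3`, the part of the gasket outside the triangle `S_w` is farther from `S_w`
than the diameter of `S_w`. -/
lemma lt_norm_sub_of_notMem_triangle (hlam : lam ∈ Ioo (0 : ℝ) (1 / 3)) {w : List (Fin 3)}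
    {x y : Plane} (hx : x ∈ triangle lam w) (hy : y ∈ gasket lam) (hyw : y ∉ triangle lam w) :
    lam ^ w.length < ‖x - y‖ := by
  have h0 := hlam.1
  have h1 : lam < 1 := by linarith [hlam.2]
  induction w using List.reverseRecOn with
  | nil =>
    obtain ⟨u, hu, hyu⟩ := mem_gasket.1 hy 0
    rw [List.length_eq_zero_iff.1 hu] at hyu
    exact absurd hyu hyw
  | append_singleton w i ih =>
    rw [List.length_append, List.length_singleton, pow_succ]
    have hp := pow_pos h0 w.length
    by_cases hy' : y ∈ triangle lam w
    · obtain ⟨j, hj⟩ := exists_mem_child hlam hy hy'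
      have hij : i ≠ j := by
        rintro rfl
        exact hyw hj
      have := le_norm_sub_of_mem_siblings h0 h1 hij hx hj
      nlinarith [hlam.2]
    · have := ih (triangle_append_subset h0 h1 _ _ hx) hy'
      nlinarith

/-- Self-similarity of the gasket. -/
lemma gasket_inter_triangle (hlam : lam ∈ Ioo (0 : ℝ) (1 / 3)) (w : List (Fin 3)) :
    gasket lam ∩ triangle lam w = wordMap lam w '' gasket lam := by
  have h0 := hlam.1
  have h1 : lam < 1 := by linarith [hlam.2]
  ext x
  constructor
  · rintro ⟨hx, p, hp, rfl⟩
    refine ⟨p, mem_gasket.2 fun j => ?_, rfl⟩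
    obtain ⟨u, hu, hxu⟩ := mem_gasket.1 hx (w.length + j)
    rw [← List.take_append_drop w.length u] at hxu
    have hl : (u.take w.length).length = w.length := by simp [hu]
    rw [eq_of_mem_triangle hlam hl (triangle_append_subset h0 h1 _ _ hxu) ⟨p, hp, rfl⟩] at hxu
    obtain ⟨q, hq, hqp⟩ := hxu
    rw [wordMap_append] at hqp
    exact ⟨u.drop w.length, by simp [hu], q, hq, wordMap_injective h0 w hqp⟩
  · rintro ⟨p, hp, rfl⟩
    have key : ∀ n, ∃ u : List (Fin 3), u.length = n ∧ wordMap lam w p ∈ triangle lam (w ++ u) := by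
      intro n
      obtain ⟨u, hu, q, hq, rfl⟩ := mem_gasket.1 hp n
      exact ⟨u, hu, q, hq, wordMap_append w u q⟩
    constructor
    · refine mem_gasket.2 fun n => ?_
      obtain ⟨u, hu, hm⟩ := key n
      rw [← List.take_append_drop n (w ++ u)] at hm
      exact ⟨(w ++ u).take n, by simp [hu], triangle_append_subset h0 h1 _ _ hm⟩
    · obtain ⟨u, -, hm⟩ := key 0
      exact triangle_append_subset h0 h1 _ _ hm

lemma gasket_inter_triangle_nonempty (hlam : lam ∈ Ioo (0 : ℝ) (1 / 3)) (w : List (Fin 3)) :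
    (gasket lam ∩ triangle lam w).Nonempty := by
  rw [gasket_inter_triangle hlam, image_nonempty]
  -- `vertex 0` is fixed by the first similitude, so it lies in all the triangles `S_{0…0}`.
  refine ⟨vertex 0, mem_gasket.2 fun n => ⟨List.replicate n 0, by simp, vertex 0,
    vertex_mem_baseTriangle 0, ?_⟩⟩
  induction n with
  | zero => rfl
  | succ n ih =>
    rw [List.replicate_succ, wordMap, Function.comp_apply, ih, sim]
    module

/-! ### The measure of the triangles -/

lemma dim_nonneg (hlam : lam ∈ Ioo (0 : ℝ) (1 / 3)) : 0 ≤ dim lam := by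
  rw [dim, neg_div]
  have h1 : Real.log lam < 0 := Real.log_neg hlam.1 (by linarith [hlam.2])
  have h3 : 0 < Real.log 3 := Real.log_pos (by norm_num)
  exact neg_nonneg.2 (div_nonpos_of_nonneg_of_nonpos h3.le h1.le)

lemma rpow_dim (hlam : lam ∈ Ioo (0 : ℝ) (1 / 3)) : lam ^ dim lam = 3⁻¹ := by
  have h1 : Real.log lam < 0 := Real.log_neg hlam.1 (by linarith [hlam.2])
  rw [Real.rpow_def_of_pos hlam.1, dim, mul_div_cancel₀ _ h1.ne, Real.exp_neg,
    Real.exp_log (by norm_num)]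

lemma pow_rpow_dim (hlam : lam ∈ Ioo (0 : ℝ) (1 / 3)) (n : ℕ) :
    (lam ^ n) ^ dim lam = (3⁻¹ : ℝ) ^ n := by
  rw [← rpow_dim hlam, ← Real.rpow_natCast, ← Real.rpow_natCast, ← Real.rpow_mul hlam.1.le,
    ← Real.rpow_mul hlam.1.le, mul_comm]

lemma hausdorffMeasure_gasket_le_one (hlam : lam ∈ Ioo (0 : ℝ) (1 / 3)) :
    Measure.hausdorffMeasure (dim lam) (gasket lam) ≤ 1 := by
  have h0 := hlam.1
  have hd : ∀ w : List (Fin 3), Metric.ediam (triangle lam w) ≤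
      ENNReal.ofReal (lam ^ w.length) := by
    intro w
    refine Metric.ediam_le fun x hx y hy => ?_
    rw [edist_dist, dist_eq_norm]
    exact ENNReal.ofReal_le_ofReal (norm_sub_le_of_mem_triangle h0 hx hy)
  have hlen : ∀ n, ∀ w : words n, w.1.length = n := fun n w => mem_words.1 w.2
  have key := Measure.hausdorffMeasure_le_liminf_sum (X := Plane) (β := ℕ)
    (ι := fun n => words n) (dim lam) (gasket lam) (l := Filter.atTop)
    (fun n => ENNReal.ofReal (lam ^ n))
    (by
      rw [← ENNReal.ofReal_zero]
      exact (ENNReal.continuous_ofReal.tendsto 0).comp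
        (tendsto_pow_atTop_nhds_zero_of_lt_one h0.le (by linarith [hlam.2])))
    (fun n w => triangle lam w.1)
    (Filter.Eventually.of_forall fun n w => by simpa only [hlen n w] using hd w.1)
    (Filter.Eventually.of_forall fun n x hx => by
      obtain ⟨w, hw, hxw⟩ := mem_gasket.1 hx n
      exact mem_iUnion.2 ⟨⟨w, mem_words.2 hw⟩, hxw⟩)
  refine key.trans (Filter.liminf_le_of_le (by isBoundedDefault) fun b hb => ?_)
  obtain ⟨n, hn⟩ := hb.exists
  refine hn.trans ?_
  have : ∀ w : words n, Metric.ediam (triangle lam w.1) ^ dim lam ≤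
      ENNReal.ofReal ((3⁻¹ : ℝ) ^ n) := by
    intro w
    rw [← pow_rpow_dim hlam, ← ENNReal.ofReal_rpow_of_nonneg (by positivity) (dim_nonneg hlam)]
    refine ENNReal.rpow_le_rpow ?_ (dim_nonneg hlam)
    simpa only [hlen n w] using hd w.1
  refine (Finset.sum_le_sum fun w _ => this w).trans ?_
  rw [Finset.sum_const, Finset.card_univ, Fintype.card_coe, card_words, nsmul_eq_mul,
    ← ENNReal.ofReal_natCast, ← ENNReal.ofReal_mul (by positivity)]
  rw [← ENNReal.ofReal_one]
  refine ENNReal.ofReal_le_ofReal (le_of_eq ?_)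
  push_cast
  rw [← mul_pow]
  norm_num

lemma isFiniteMeasure_gasketMeasure (hlam : lam ∈ Ioo (0 : ℝ) (1 / 3)) :
    IsFiniteMeasure (gasketMeasure lam) := by
  refine ⟨?_⟩
  rw [gasketMeasure, Measure.restrict_apply_univ]
  exact (hausdorffMeasure_gasket_le_one hlam).trans_lt ENNReal.one_lt_top

open scoped Pointwise in
lemma gasketMeasure_triangle (hlam : lam ∈ Ioo (0 : ℝ) (1 / 3)) (w : List (Fin 3)) :
    gasketMeasure lam (triangle lam w) =
      ENNReal.ofReal ((3⁻¹ : ℝ) ^ w.length) * gasketMeasure lam univ := by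
  have h0 := hlam.1
  have hw : wordMap lam w '' gasket lam =
      IsometryEquiv.addRight (wordMap lam w 0) '' (lam ^ w.length • gasket lam) := by
    rw [← image_smul, image_image, funext (wordMap_eq (lam := lam) w)]
    simp
  rw [gasketMeasure, Measure.restrict_apply (measurableSet_triangle w), inter_comm,
    gasket_inter_triangle hlam, Measure.restrict_apply_univ, hw,
    (IsometryEquiv.addRight (wordMap lam w 0)).isometry.hausdorffMeasure_image
      (Or.inl (dim_nonneg hlam)),
    Measure.hausdorffMeasure_smul₀ (dim_nonneg hlam) (pow_ne_zero _ h0.ne')]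
  rw [ENNReal.smul_def, smul_eq_mul, ← pow_rpow_dim hlam]
  congr 1
  rw [← ENNReal.ofReal_coe_nnreal]
  congr 1
  rw [NNReal.coe_rpow, coe_nnnorm, Real.norm_of_nonneg (by positivity)]

lemma ae_mem_gasket : ∀ᵐ x ∂gasketMeasure lam, x ∈ gasket lam :=
  ae_restrict_mem measurableSet_gasket

lemma disjoint_triangle (hlam : lam ∈ Ioo (0 : ℝ) (1 / 3)) {v w : List (Fin 3)}
    (hvw : v.length = w.length) (hne : v ≠ w) : Disjoint (triangle lam v) (triangle lam w) :=
  disjoint_left.2 fun _ hv hw => hne (eq_of_mem_triangle hlam hvw hv hw)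

lemma triangle_ae_eq_iUnion (hlam : lam ∈ Ioo (0 : ℝ) (1 / 3)) (w : List (Fin 3)) :
    triangle lam w =ᵐ[gasketMeasure lam] ⋃ i, triangle lam (w ++ [i]) := by
  filter_upwards [ae_mem_gasket] with x hx
  refine propext (Iff.trans ?_ mem_iUnion.symm)
  exact ⟨exists_mem_child hlam hx, fun ⟨i, hi⟩ =>
    triangle_append_subset hlam.1 (by linarith [hlam.2]) _ _ hi⟩

lemma pairwise_disjoint_children (hlam : lam ∈ Ioo (0 : ℝ) (1 / 3)) (w : List (Fin 3)) :
    Pairwise fun i j => Disjoint (triangle lam (w ++ [i])) (triangle lam (w ++ [j])) :=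
  fun i j hij => disjoint_triangle hlam (by simp) (by simpa using hij)

lemma setIntegral_triangle (hlam : lam ∈ Ioo (0 : ℝ) (1 / 3)) (w : List (Fin 3))
    {g : Plane → ℝ} (hg : Integrable g (gasketMeasure lam)) :
    ∫ y in triangle lam w, g y ∂gasketMeasure lam =
      ∑ i, ∫ y in triangle lam (w ++ [i]), g y ∂gasketMeasure lam := by
  rw [setIntegral_congr_set (triangle_ae_eq_iUnion hlam w)]
  exact integral_iUnion_fintype (fun i => measurableSet_triangle _)
    (pairwise_disjoint_children hlam w) fun i => hg.integrableOn

lemma gasket_subset_triangle_nil : gasket lam ⊆ triangle lam [] := by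
  intro x hx
  obtain ⟨w, hw, hxw⟩ := mem_gasket.1 hx 0
  rwa [List.length_eq_zero_iff.1 hw] at hxw

lemma sum_words_setIntegral (hlam : lam ∈ Ioo (0 : ℝ) (1 / 3)) {g : Plane → ℝ}
    (hg : Integrable g (gasketMeasure lam)) (n : ℕ) :
    ∑ w ∈ words n, ∫ y in triangle lam w, g y ∂gasketMeasure lam =
      ∫ y, g y ∂gasketMeasure lam := by
  induction n with
  | zero =>
    rw [words, Finset.sum_singleton]
    refine Eq.trans (setIntegral_congr_set ?_) setIntegral_univ
    filter_upwards [ae_mem_gasket] with x hx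
    exact propext ⟨fun _ => trivial, fun _ => gasket_subset_triangle_nil hx⟩
  | succ n ih => rw [sum_words_succ, ← ih, Finset.sum_congr rfl fun w _ =>
      (setIntegral_triangle hlam w hg).symm]

/-! ### The kernel on the gasket -/

lemma smul_mem_sector {k : Fin 6} {v : Plane} (hv : v ∈ sector e k) {c : ℝ} (hc : 0 < c) :
    c • v ∈ sector e k := by
  obtain ⟨h0, t, ht, hvt⟩ := hv
  refine ⟨smul_ne_zero hc.ne' h0, t, ht, ?_⟩
  conv_lhs => rw [hvt]
  rw [norm_smul, Real.norm_of_nonneg hc.le, mul_smul]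

lemma direction_mem_sphere {x y : Plane} (hxy : x ≠ y) :
    ‖x - y‖⁻¹ • (x - y) ∈ Metric.sphere (0 : Plane) 1 := by
  rw [mem_sphere_zero_iff_norm, norm_smul, norm_inv, norm_norm,
    inv_mul_cancel₀ (norm_ne_zero_iff.2 (sub_ne_zero.2 hxy))]

lemma angular_eq_of_mem_sector (hOm : IsAngularPart e Om) {x y : Plane} (hxy : x ≠ y)
    {k : Fin 6} (hk : y - x ∈ sector e k) : Om (‖x - y‖⁻¹ • (x - y)) = (-1) ^ (k : ℕ) := by
  refine hOm.sign _ (direction_mem_sphere hxy) k ?_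
  rw [zero_sub, ← smul_neg, neg_sub]
  exact smul_mem_sector hk (inv_pos.2 (norm_pos_iff.2 (sub_ne_zero.2 hxy)))

lemma angular_symm (hOm : IsAngularPart e Om) {x y : Plane} (hxy : x ≠ y) :
    Om (‖y - x‖⁻¹ • (y - x)) = -Om (‖x - y‖⁻¹ • (x - y)) := by
  rw [← hOm.odd _ (direction_mem_sphere hxy), ← smul_neg, neg_sub, norm_sub_rev]

lemma abs_angular_eq_one (he : IsAdmissibleAngle lam e) (hOm : IsAngularPart e Om)
    {x y : Plane} (hx : x ∈ gasket lam) (hy : y ∈ gasket lam) (hxy : x ≠ y) :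
    |Om (‖x - y‖⁻¹ • (x - y))| = 1 := by
  obtain ⟨k, hk⟩ := he.cover x hx y hy hxy
  rw [angular_eq_of_mem_sector hOm hxy hk, abs_pow, abs_neg, abs_one, one_pow]

lemma ne_of_mem_siblings (hlam : lam ∈ Ioo (0 : ℝ) (1 / 3)) {w : List (Fin 3)} {i j : Fin 3}
    (hij : i ≠ j) {x y : Plane} (hx : x ∈ triangle lam (w ++ [i]))
    (hy : y ∈ triangle lam (w ++ [j])) : x ≠ y := by
  rintro rfl
  exact disjoint_left.1 (pairwise_disjoint_children hlam w hij) hx hy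

/-- The sign of the kernel between two distinct children of `w` depends on the children only, and
is, up to a sign depending on `w`, the cyclic one: `+` from `i` to `i + 1` and `-` from `i` to
`i + 2`. -/
lemma exists_sign (hlam : lam ∈ Ioo (0 : ℝ) (1 / 3)) (he : IsAdmissibleAngle lam e)
    (hOm : IsAngularPart e Om) (w : List (Fin 3)) :
    ∃ s : ℝ, s ^ 2 = 1 ∧ ∀ i, ∀ x ∈ gasket lam ∩ triangle lam (w ++ [i]),
      (∀ y ∈ gasket lam ∩ triangle lam (w ++ [i + 1]), Om (‖x - y‖⁻¹ • (x - y)) = s) ∧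
      (∀ y ∈ gasket lam ∩ triangle lam (w ++ [i + 2]), Om (‖x - y‖⁻¹ • (x - y)) = -s) := by
  set g : Plane → Plane → ℝ := fun x y => Om (‖x - y‖⁻¹ • (x - y)) with hg
  have symm : ∀ i j, i ≠ j → ∀ x ∈ gasket lam ∩ triangle lam (w ++ [i]),
      ∀ y ∈ gasket lam ∩ triangle lam (w ++ [j]), g y x = -g x y := fun i j hij x hx y hy =>
    angular_symm hOm (ne_of_mem_siblings hlam hij hx.2 hy.2)
  have left : ∀ i j, i ≠ j → ∀ x ∈ gasket lam ∩ triangle lam (w ++ [i]),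
      ∀ x' ∈ gasket lam ∩ triangle lam (w ++ [i]),
      ∀ y ∈ gasket lam ∩ triangle lam (w ++ [j]), g x y = g x' y := by
    intro i j hij x hx x' hx' y hy
    have hxy := ne_of_mem_siblings hlam hij hx.2 hy.2
    obtain ⟨k, hk⟩ := he.cover x hx.1 y hy.1 hxy
    exact (angular_eq_of_mem_sector hOm hxy hk).trans (angular_eq_of_mem_sector hOm
      (ne_of_mem_siblings hlam hij hx'.2 hy.2)
      (he.same w i j hij x hx.2 x' hx'.2 y hy.2 k hk)).symm
  have const : ∀ i j, i ≠ j → ∀ x ∈ gasket lam ∩ triangle lam (w ++ [i]),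
      ∀ x' ∈ gasket lam ∩ triangle lam (w ++ [i]),
      ∀ y ∈ gasket lam ∩ triangle lam (w ++ [j]),
      ∀ y' ∈ gasket lam ∩ triangle lam (w ++ [j]), g x y = g x' y' := by
    intro i j hij x hx x' hx' y hy y' hy'
    rw [left i j hij x hx x' hx' y hy, symm j i hij.symm y hy x' hx',
      symm j i hij.symm y' hy' x' hx', left j i hij.symm y hy y' hy' x' hx']
  have flip : ∀ i j l, i ≠ j → j ≠ l → i ≠ l → ∀ x ∈ gasket lam ∩ triangle lam (w ++ [i]),
      ∀ y ∈ gasket lam ∩ triangle lam (w ++ [j]),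
      ∀ z ∈ gasket lam ∩ triangle lam (w ++ [l]), g x z = -g x y := by
    intro i j l hij hjl hil x hx y hy z hz
    have hxy := ne_of_mem_siblings hlam hij hx.2 hy.2
    have hxz := ne_of_mem_siblings hlam hil hx.2 hz.2
    obtain ⟨k, hk⟩ := he.cover x hx.1 y hy.1 hxy
    have e1 : g x y = (-1) ^ (k : ℕ) := angular_eq_of_mem_sector hOm hxy hk
    rcases he.adjacent w i j l hij hjl hil x hx.2 y hy.2 z hz.2 k hk with hm | hm
    · have e2 : g x z = (-1) ^ ((k + 1 : Fin 6) : ℕ) := angular_eq_of_mem_sector hOm hxz hm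
      rw [e1, e2]
      fin_cases k <;> norm_num [Fin.val_add]
    · have e2 : g x z = (-1) ^ ((k - 1 : Fin 6) : ℕ) := angular_eq_of_mem_sector hOm hxz hm
      rw [e1, e2]
      fin_cases k <;> norm_num [Fin.sub_def]
  choose p hp using fun i : Fin 3 => gasket_inter_triangle_nonempty hlam (w ++ [i])
  have h02 := flip 0 1 2 (by decide) (by decide) (by decide) _ (hp 0) _ (hp 1) _ (hp 2)
  have h10 := symm 0 1 (by decide) _ (hp 0) _ (hp 1)
  have h12 := flip 1 0 2 (by decide) (by decide) (by decide) _ (hp 1) _ (hp 0) _ (hp 2)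
  have h20 := symm 0 2 (by decide) _ (hp 0) _ (hp 2)
  have h21 := symm 1 2 (by decide) _ (hp 1) _ (hp 2)
  refine ⟨g (p 0) (p 1), ?_, fun i x hx => ⟨fun y hy => ?_, fun y hy => ?_⟩⟩
  · rw [← sq_abs, abs_angular_eq_one he hOm (hp 0).1 (hp 1).1
      (ne_of_mem_siblings hlam (by decide) (hp 0).2 (hp 1).2), one_pow]
  · refine (const i (i + 1) (by simp) x hx (p i) (hp i) y hy (p (i + 1)) (hp _)).trans ?_
    fin_cases i
    · rfl
    · change g (p 1) (p 2) = _
      rw [h12, h10, neg_neg]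
    · change g (p 2) (p 0) = _
      rw [h20, h02, neg_neg]
  · refine (const i (i + 2) (by simp) x hx (p i) (hp i) y hy (p (i + 2)) (hp _)).trans ?_
    fin_cases i
    · exact h02
    · exact h10
    · change g (p 2) (p 1) = _
      rw [h21, h12, h10, neg_neg]

lemma radial_eq (hlam : lam ∈ Ioo (0 : ℝ) (1 / 3)) (hh : IsRadialPart lam h) (n : ℕ) {r : ℝ}
    (hr : r ∈ Icc ((1 - 2 * lam) * lam ^ n) (lam ^ n)) : h r = (3⁻¹ : ℝ) ^ n := by
  have h0 := hlam.1
  have key := hh.plateau (n + 1) (by simp) r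
  rw [add_tsub_cancel_right] at key
  rw [key ⟨le_of_eq_of_le ?_ hr.1, hr.2⟩, ← pow_rpow_dim hlam, ← Real.rpow_natCast,
    ← Real.rpow_mul h0.le]
  · push_cast
    congr 1
    ring
  · rw [pow_succ]
    field_simp

lemma radial_siblings (hlam : lam ∈ Ioo (0 : ℝ) (1 / 3)) (hh : IsRadialPart lam h)
    {w : List (Fin 3)} {i j : Fin 3} (hij : i ≠ j) {x y : Plane}
    (hx : x ∈ triangle lam (w ++ [i])) (hy : y ∈ triangle lam (w ++ [j])) :
    h ‖x - y‖ = (3⁻¹ : ℝ) ^ w.length := by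
  have h1 : lam < 1 := by linarith [hlam.2]
  exact radial_eq hlam hh _ ⟨le_norm_sub_of_mem_siblings hlam.1 h1 hij hx hy,
    norm_sub_le_of_mem_triangle hlam.1 (triangle_append_subset hlam.1 h1 _ _ hx)
      (triangle_append_subset hlam.1 h1 _ _ hy)⟩

lemma abs_kernel_le (hlam : lam ∈ Ioo (0 : ℝ) (1 / 3)) (he : IsAdmissibleAngle lam e)
    (hOm : IsAngularPart e Om) (hh : IsRadialPart lam h) {x y : Plane} (hx : x ∈ gasket lam)
    (hy : y ∈ gasket lam) {n : ℕ} (hn : lam ^ n < ‖x - y‖) : |kernel Om h x y| ≤ 3 ^ n := by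
  have hp : 0 < lam ^ n := pow_pos hlam.1 n
  have hxy : x ≠ y := by
    rintro rfl
    rw [sub_self, norm_zero] at hn
    linarith
  have h1 : (3⁻¹ : ℝ) ^ n ≤ h ‖x - y‖ := by
    rw [← radial_eq hlam hh n (r := lam ^ n) ⟨by nlinarith [hlam.1], le_rfl⟩]
    exact hh.mono hp (hp.trans hn) hn.le
  have h2 : 0 < (3⁻¹ : ℝ) ^ n := by positivity
  rw [kernel, abs_div, abs_angular_eq_one he hOm hx hy hxy, abs_of_pos (h2.trans_le h1)]
  refine (one_div_le_one_div_of_le h2 h1).trans (le_of_eq ?_)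
  rw [one_div, ← inv_pow, inv_inv]

lemma measurable_kernel (hOm : IsAngularPart e Om) (hh : IsRadialPart lam h) :
    Measurable (indicator {p : Plane × Plane | p.1 ≠ p.2} fun p => kernel Om h p.1 p.2) := by
  set U : Set (Plane × Plane) := {p | p.1 ≠ p.2} with hU
  have hUo : IsOpen U := isOpen_ne_fun continuous_fst continuous_snd
  have meas : ∀ g : Plane × Plane → ℝ, ContinuousOn g U → Measurable (U.indicator g) := by
    intro g hg
    rw [← piecewise_eq_indicator]
    exact hg.measurable_piecewise continuousOn_const hUo.measurableSet
  have hn : ∀ p ∈ U, ‖p.1 - p.2‖ ≠ 0 := fun p hp => norm_ne_zero_iff.2 (sub_ne_zero.2 hp)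
  have hnum : ContinuousOn (fun p : Plane × Plane => Om (‖p.1 - p.2‖⁻¹ • (p.1 - p.2))) U := by
    have hdir : ContinuousOn (fun p : Plane × Plane => ‖p.1 - p.2‖⁻¹ • (p.1 - p.2)) U := by
      refine ContinuousOn.smul (ContinuousOn.inv₀ ?_ hn) ?_ <;> fun_prop
    rw [continuousOn_iff_continuous_domRestrict] at hdir ⊢
    exact hOm.smooth.continuous.comp
      (hdir.subtype_mk fun p => direction_mem_sphere p.2)
  have hden : ContinuousOn (fun p : Plane × Plane => h ‖p.1 - p.2‖) U :=
    hh.smooth.continuousOn.comp (by fun_prop) fun p hp =>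
      norm_pos_iff.2 (sub_ne_zero.2 hp)
  convert (meas _ hnum).div (meas _ hden) using 1
  ext p
  by_cases hp : p ∈ U <;> simp [hp, kernel]

lemma aestronglyMeasurable_kernel (hOm : IsAngularPart e Om) (hh : IsRadialPart lam h)
    (x : Plane) {μ : Measure Plane} (hμ : ∀ᵐ y ∂μ, x ≠ y) :
    AEStronglyMeasurable (fun y => kernel Om h x y) μ := by
  refine ((measurable_kernel hOm hh).comp
    (measurable_prodMk_left (x := x))).aestronglyMeasurable.congr ?_
  filter_upwards [hμ] with y hy
  exact indicator_of_mem (s := {p : Plane × Plane | p.1 ≠ p.2}) hy _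

lemma ae_abs_kernel_le (hlam : lam ∈ Ioo (0 : ℝ) (1 / 3)) (he : IsAdmissibleAngle lam e)
    (hOm : IsAngularPart e Om) (hh : IsRadialPart lam h) (hx : x ∈ gasket lam)
    (hB : MeasurableSet B) (hsep : ∀ y ∈ B, y ∈ gasket lam → lam ^ n < ‖x - y‖) :
    ∀ᵐ y ∂(gasketMeasure lam).restrict B, ‖kernel Om h x y‖ ≤ 3 ^ n := by
  filter_upwards [ae_restrict_mem hB, ae_restrict_of_ae ae_mem_gasket] with y hyB hy
  exact abs_kernel_le hlam he hOm hh hx hy (hsep y hyB hy)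

lemma integrableOn_kernel_mul (hlam : lam ∈ Ioo (0 : ℝ) (1 / 3)) (he : IsAdmissibleAngle lam e)
    (hOm : IsAngularPart e Om) (hh : IsRadialPart lam h)
    (hf : Integrable f (gasketMeasure lam)) (hx : x ∈ gasket lam)
    (hB : MeasurableSet B) (hsep : ∀ y ∈ B, y ∈ gasket lam → lam ^ n < ‖x - y‖) :
    IntegrableOn (fun y => kernel Om h x y * f y) B (gasketMeasure lam) := by
  refine hf.integrableOn.bdd_mul (c := 3 ^ n) (aestronglyMeasurable_kernel hOm hh x ?_)
    (ae_abs_kernel_le hlam he hOm hh hx hB hsep)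
  filter_upwards [ae_restrict_mem hB, ae_restrict_of_ae ae_mem_gasket] with y hyB hy
  rintro rfl
  have := hsep x hyB hy
  rw [sub_self, norm_zero] at this
  linarith [pow_pos hlam.1 n]

lemma abs_setIntegral_kernel_mul_le (hlam : lam ∈ Ioo (0 : ℝ) (1 / 3))
    (he : IsAdmissibleAngle lam e) (hOm : IsAngularPart e Om) (hh : IsRadialPart lam h)
    (hf : Integrable f (gasketMeasure lam)) (hx : x ∈ gasket lam)
    (hB : MeasurableSet B) (hsep : ∀ y ∈ B, y ∈ gasket lam → lam ^ n < ‖x - y‖) :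
    |∫ y in B, kernel Om h x y * f y ∂gasketMeasure lam| ≤
      3 ^ n * ∫ y in B, |f y| ∂gasketMeasure lam := by
  rw [← integral_const_mul, ← Real.norm_eq_abs]
  refine norm_integral_le_of_norm_le (hf.abs.integrableOn.const_mul _) ?_
  filter_upwards [ae_abs_kernel_le hlam he hOm hh hx hB hsep] with y hy
  rw [norm_mul]
  exact mul_le_mul_of_nonneg_right hy (norm_nonneg _)

/-! ### The truncated operators as a martingale -/

/-- The integral of `f` over `S_w`, multiplied by `3 ^ |w|`: up to the constant factor `μ(E)`, the
mean of `f` on `S_w`. Not dividing by `μ(E)` avoids having to know that it is nonzero. -/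
def density (lam : ℝ) (f : Plane → ℝ) (w : List (Fin 3)) : ℝ :=
  3 ^ w.length * ∫ y in triangle lam w, f y ∂gasketMeasure lam

/-- The integral defining the operator at `x`, truncated to the complement of `S_w`. -/
def outerIntegral (lam : ℝ) (Om : Plane → ℝ) (h : ℝ → ℝ) (f : Plane → ℝ) (w : List (Fin 3))
    (x : Plane) : ℝ :=
  ∫ y in (triangle lam w)ᶜ, kernel Om h x y * f y ∂gasketMeasure lam

lemma sum_density (hlam : lam ∈ Ioo (0 : ℝ) (1 / 3)) (hf : Integrable f (gasketMeasure lam))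
    (w : List (Fin 3)) : ∑ i, density lam f (w ++ [i]) = 3 * density lam f w := by
  simp only [density, List.length_append, List.length_singleton, ← Finset.mul_sum]
  rw [← setIntegral_triangle hlam w hf, pow_succ]
  ring

lemma density_nonneg (hf : ∀ y, 0 ≤ f y) (w : List (Fin 3)) : 0 ≤ density lam f w :=
  mul_nonneg (by positivity) (integral_nonneg hf)

lemma abs_density_le (w : List (Fin 3)) :
    |density lam f w| ≤ density lam (fun y => |f y|) w := by
  rw [density, abs_mul, abs_of_nonneg (by positivity : (0 : ℝ) ≤ 3 ^ w.length)]
  exact mul_le_mul_of_nonneg_left abs_integral_le_integral_abs (by positivity)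

/-- The Cauchy–Schwarz inequality against the constant function `1`. -/
lemma sq_setIntegral_abs_le {α : Type*} [MeasurableSpace α] {μ : Measure α} [IsFiniteMeasure μ]
    {g : α → ℝ} (hg : MemLp g 2 μ) (B : Set α) :
    (∫ y in B, |g y| ∂μ) ^ 2 ≤ μ.real B * ∫ y in B, g y ^ 2 ∂μ := by
  have h1 : IntegrableOn (fun y => |g y|) B μ := (hg.integrable one_le_two).abs.integrableOn
  have h2 : IntegrableOn (fun y => g y ^ 2) B μ := hg.integrable_sq.integrableOn
  have key : ∀ t : ℝ, 0 ≤ μ.real B * (t * t) + (-2 * ∫ y in B, |g y| ∂μ) * t +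
      ∫ y in B, g y ^ 2 ∂μ := by
    intro t
    have e : ∫ y in B, (t - |g y|) ^ 2 ∂μ = μ.real B * (t * t) + (-2 * ∫ y in B, |g y| ∂μ) * t +
        ∫ y in B, g y ^ 2 ∂μ := by
      have : ∀ y, (t - |g y|) ^ 2 = (t * t + (-2 * t) * |g y|) + g y ^ 2 := by
        intro y
        rw [← sq_abs (g y)]
        ring
      simp only [this]
      have h3 : IntegrableOn (fun y => t * t + (-2 * t) * |g y|) B μ :=
        (integrable_const (t * t)).add (h1.const_mul _)
      rw [integral_add h3 h2, integral_add (integrable_const _) (h1.const_mul _), setIntegral_const,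
        integral_const_mul, smul_eq_mul]
      ring
    rw [← e]
    exact integral_nonneg fun y => sq_nonneg _
  have := discrim_le_zero key
  rw [discrim] at this
  linarith

lemma sq_density_abs_le (hlam : lam ∈ Ioo (0 : ℝ) (1 / 3)) (hf : MemLp f 2 (gasketMeasure lam))
    (w : List (Fin 3)) : density lam (fun y => |f y|) w ^ 2 ≤
      3 ^ w.length * ∫ y in triangle lam w, f y ^ 2 ∂gasketMeasure lam := by
  have := isFiniteMeasure_gasketMeasure hlam
  have hm : (gasketMeasure lam).real (triangle lam w) ≤ (3⁻¹ : ℝ) ^ w.length := by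
    refine ENNReal.toReal_le_of_le_ofReal (by positivity) ?_
    rw [gasketMeasure_triangle hlam, gasketMeasure, Measure.restrict_apply_univ]
    exact mul_le_of_le_one_right' (hausdorffMeasure_gasket_le_one hlam)
  have hJ : 0 ≤ ∫ y in triangle lam w, f y ^ 2 ∂gasketMeasure lam :=
    integral_nonneg fun y => sq_nonneg _
  rw [density, mul_pow]
  refine (mul_le_mul_of_nonneg_left ((sq_setIntegral_abs_le hf _).trans
    (mul_le_mul_of_nonneg_right hm hJ)) (by positivity)).trans (le_of_eq ?_)
  rw [inv_pow]
  field_simp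

lemma integrableOn_compl_triangle (hlam : lam ∈ Ioo (0 : ℝ) (1 / 3))
    (he : IsAdmissibleAngle lam e) (hOm : IsAngularPart e Om) (hh : IsRadialPart lam h)
    (hf : Integrable f (gasketMeasure lam)) {w : List (Fin 3)} {x : Plane}
    (hx : x ∈ gasket lam ∩ triangle lam w) :
    IntegrableOn (fun y => kernel Om h x y * f y) (triangle lam w)ᶜ (gasketMeasure lam) :=
  integrableOn_kernel_mul hlam he hOm hh hf hx.1 (measurableSet_triangle w).compl fun _ hy hyE =>
    lt_norm_sub_of_notMem_triangle hlam hx.2 hyE hy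

lemma setIntegral_kernel_sibling (hlam : lam ∈ Ioo (0 : ℝ) (1 / 3)) (hh : IsRadialPart lam h)
    {w : List (Fin 3)} {i j : Fin 3} (hij : i ≠ j) {x : Plane} {s : ℝ}
    (hx : x ∈ triangle lam (w ++ [i]))
    (hs : ∀ y ∈ gasket lam ∩ triangle lam (w ++ [j]), Om (‖x - y‖⁻¹ • (x - y)) = s) :
    ∫ y in triangle lam (w ++ [j]), kernel Om h x y * f y ∂gasketMeasure lam =
      s / 3 * density lam f (w ++ [j]) := by
  have : ∀ᵐ y ∂(gasketMeasure lam).restrict (triangle lam (w ++ [j])),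
      kernel Om h x y * f y = s * 3 ^ w.length * f y := by
    filter_upwards [ae_restrict_mem (measurableSet_triangle _),
      ae_restrict_of_ae ae_mem_gasket] with y hy hyE
    rw [kernel, hs y ⟨hyE, hy⟩, radial_siblings hlam hh hij hx hy, inv_pow, div_inv_eq_mul]
  rw [integral_congr_ae this, integral_const_mul, density, List.length_append,
    List.length_singleton, pow_succ]
  ring

lemma outerIntegral_append (hlam : lam ∈ Ioo (0 : ℝ) (1 / 3)) (he : IsAdmissibleAngle lam e)
    (hOm : IsAngularPart e Om) (hh : IsRadialPart lam h)
    (hf : Integrable f (gasketMeasure lam)) {w : List (Fin 3)} {i : Fin 3} {x : Plane} {s : ℝ}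
    (hx : x ∈ gasket lam ∩ triangle lam (w ++ [i]))
    (hs : (∀ y ∈ gasket lam ∩ triangle lam (w ++ [i + 1]), Om (‖x - y‖⁻¹ • (x - y)) = s) ∧
      (∀ y ∈ gasket lam ∩ triangle lam (w ++ [i + 2]), Om (‖x - y‖⁻¹ • (x - y)) = -s)) :
    outerIntegral lam Om h f (w ++ [i]) x = outerIntegral lam Om h f w x +
      s / 3 * (density lam f (w ++ [i + 1]) - density lam f (w ++ [i + 2])) := by
  have h1 : lam < 1 := by linarith [hlam.2]
  have n1 : i ≠ i + 1 := by simp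
  have n2 : i ≠ i + 2 := by simp
  have n3 : i + 1 ≠ i + 2 := by simp
  have cover : ∀ i j : Fin 3, j = i ∨ j = i + 1 ∨ j = i + 2 := by decide
  have hsub := triangle_append_subset hlam.1 h1 w
  have hdis := pairwise_disjoint_children hlam w
  have hset : ((triangle lam (w ++ [i]))ᶜ : Set Plane) =ᵐ[gasketMeasure lam]
      ((triangle lam w)ᶜ ∪ (triangle lam (w ++ [i + 1]) ∪ triangle lam (w ++ [i + 2])) :
        Set Plane) := by
    filter_upwards [ae_mem_gasket] with y hy
    refine propext ⟨fun hyi => ?_, ?_⟩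
    · by_cases hyw : y ∈ triangle lam w
      · obtain ⟨j, hj⟩ := exists_mem_child hlam hy hyw
        rcases cover i j with rfl | rfl | rfl
        · exact absurd hj hyi
        · exact Or.inr (Or.inl hj)
        · exact Or.inr (Or.inr hj)
      · exact Or.inl hyw
    · rintro (hy' | hy' | hy') hyi
      · exact hy' (hsub _ hyi)
      · exact disjoint_left.1 (hdis n1) hyi hy'
      · exact disjoint_left.1 (hdis n2) hyi hy'
  have hint := (integrableOn_compl_triangle hlam he hOm hh hf hx).congr_set_ae hset.symm
  rw [outerIntegral, setIntegral_congr_set hset,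
    setIntegral_union (disjoint_compl_left.mono_right (union_subset (hsub _) (hsub _)))
      ((measurableSet_triangle _).union (measurableSet_triangle _))
      hint.left_of_union hint.right_of_union,
    setIntegral_union (hdis n3) (measurableSet_triangle _) hint.right_of_union.left_of_union
      hint.right_of_union.right_of_union,
    setIntegral_kernel_sibling hlam hh n1 hx.2 hs.1,
    setIntegral_kernel_sibling hlam hh n2 hx.2 hs.2, outerIntegral]
  ring

lemma outerIntegral_nil (x : Plane) : outerIntegral lam Om h f [] x = 0 := by
  refine setIntegral_measure_zero _ (measure_eq_zero_iff_ae_notMem.2 ?_)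
  filter_upwards [ae_mem_gasket] with y hy
  simpa using gasket_subset_triangle_nil hy

/-- A truncation of the operator differs from the truncation to the complement of a suitable
triangle `S_w` by an integral over a part of `S_w` on which `|K| ≤ 3 ^ (|w| + 1)`. -/
lemma exists_abs_truncated_le (hlam : lam ∈ Ioo (0 : ℝ) (1 / 3)) (he : IsAdmissibleAngle lam e)
    (hOm : IsAngularPart e Om) (hh : IsRadialPart lam h)
    (hf : Integrable f (gasketMeasure lam)) {x : Plane} (hx : x ∈ gasket lam) {r : ℝ}
    (hr : 0 < r) : ∃ w, x ∈ triangle lam w ∧ |truncated lam Om h r f x| ≤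
      |outerIntegral lam Om h f w x| + 3 * density lam (fun y => |f y|) w := by
  have h0 := hlam.1
  have h1 : lam < 1 := by linarith [hlam.2]
  have hmeas : MeasurableSet {y : Plane | r < ‖x - y‖} :=
    measurableSet_lt measurable_const (by fun_prop)
  rcases lt_or_ge 1 r with hr1 | hr1
  · refine ⟨[], gasket_subset_triangle_nil hx, ?_⟩
    have : truncated lam Om h r f x = 0 := by
      refine setIntegral_measure_zero _ (measure_eq_zero_iff_ae_notMem.2 ?_)
      filter_upwards [ae_mem_gasket] with y hy
      have := norm_sub_le_of_mem_triangle h0 (gasket_subset_triangle_nil hx)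
        (gasket_subset_triangle_nil hy)
      rw [List.length_nil, pow_zero] at this
      exact not_lt.2 (this.trans hr1.le)
    rw [this, abs_zero]
    exact add_nonneg (abs_nonneg _)
      (mul_nonneg (by norm_num) (density_nonneg (fun _ => abs_nonneg _) _))
  · obtain ⟨n, hn1, hn2⟩ := exists_nat_pow_near_of_lt_one hr hr1 h0 h1
    obtain ⟨w, rfl, hxw⟩ := mem_gasket.1 hx n
    refine ⟨w, hxw, ?_⟩
    set B : Set Plane := triangle lam w ∩ {y | r < ‖x - y‖} with hB
    have hBm : MeasurableSet B := (measurableSet_triangle w).inter hmeas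
    have hset : ({y | r < ‖x - y‖} : Set Plane) =ᵐ[gasketMeasure lam]
        ((triangle lam w)ᶜ ∪ B : Set Plane) := by
      filter_upwards [ae_mem_gasket] with y hy
      refine propext ⟨fun hry => ?_, ?_⟩
      · by_cases hyw : y ∈ triangle lam w
        · exact Or.inr ⟨hyw, hry⟩
        · exact Or.inl hyw
      · rintro (hy' | hy')
        · exact hn2.trans_lt (lt_norm_sub_of_notMem_triangle hlam hxw hy hy')
        · exact hy'.2
    have hsep : ∀ y ∈ B, y ∈ gasket lam → lam ^ (w.length + 1) < ‖x - y‖ :=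
      fun y hy _ => hn1.trans hy.2
    rw [truncated, setIntegral_congr_set hset,
      setIntegral_union (disjoint_compl_left.mono_right inter_subset_left) hBm
        (integrableOn_compl_triangle hlam he hOm hh hf ⟨hx, hxw⟩)
        (integrableOn_kernel_mul hlam he hOm hh hf hx hBm hsep)]
    refine (abs_add_le _ _).trans (add_le_add le_rfl ?_)
    refine (abs_setIntegral_kernel_mul_le hlam he hOm hh hf hx hBm hsep).trans ?_
    rw [density, pow_succ', mul_assoc]
    refine mul_le_mul_of_nonneg_left (mul_le_mul_of_nonneg_left ?_ (by positivity)) (by norm_num)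
    exact setIntegral_mono_set hf.abs.integrableOn
      (Filter.Eventually.of_forall fun _ => abs_nonneg _)
      inter_subset_left.eventuallyLE

/-- The truncations of the operator are dominated by a nonnegative submartingale on the ternary
tree which is bounded in `L²`. -/
lemma exists_submartingale (hlam : lam ∈ Ioo (0 : ℝ) (1 / 3)) (he : IsAdmissibleAngle lam e)
    (hOm : IsAngularPart e Om) (hh : IsRadialPart lam h) (hf : MemLp f 2 (gasketMeasure lam)) :
    ∃ F : List (Fin 3) → ℝ, (∀ w, 0 ≤ F w) ∧ (∀ w, 3 * F w ≤ ∑ i, F (w ++ [i])) ∧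
      (∀ n, ∑ w ∈ words n, F w ^ 2 ≤ 19 * (3 ^ n * ∫ y, f y ^ 2 ∂gasketMeasure lam)) ∧
      ∀ x ∈ gasket lam, ∀ r : ℝ, 0 < r →
        ∃ w, x ∈ triangle lam w ∧ |truncated lam Om h r f x| ≤ F w := by
  have := isFiniteMeasure_gasketMeasure hlam
  have hfi : Integrable f (gasketMeasure lam) := hf.integrable one_le_two
  choose s hs1 hs using exists_sign hlam he hOm
  have hconst : ∀ w, ∃ t, ∀ x ∈ gasket lam ∩ triangle lam w,
      outerIntegral lam Om h f w x = t := by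
    intro w
    induction w using List.reverseRecOn with
    | nil => exact ⟨0, fun x _ => outerIntegral_nil x⟩
    | append_singleton w i ih =>
      obtain ⟨t, ht⟩ := ih
      refine ⟨t + s w / 3 * (density lam f (w ++ [i + 1]) - density lam f (w ++ [i + 2])),
        fun x hx => (outerIntegral_append hlam he hOm hh hfi hx (hs w i x hx)).trans ?_⟩
      rw [ht x ⟨hx.1, triangle_append_subset hlam.1 (by linarith [hlam.2]) _ _ hx.2⟩]
  choose T hT using hconst
  set b := density lam f with hb
  set a := density lam (fun y => |f y|) with ha
  have hT0 : T [] = 0 := by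
    obtain ⟨x, hx⟩ := gasket_inter_triangle_nonempty hlam []
    rw [← hT [] x hx, outerIntegral_nil]
  have hTs : ∀ w i, T (w ++ [i]) =
      T w + s w / 3 * (b (w ++ [i + 1]) - b (w ++ [i + 2])) := by
    intro w i
    obtain ⟨x, hx⟩ := gasket_inter_triangle_nonempty hlam (w ++ [i])
    rw [← hT _ x hx, outerIntegral_append hlam he hOm hh hfi hx (hs w i x hx),
      hT w x ⟨hx.1, triangle_append_subset hlam.1 (by linarith [hlam.2]) _ _ hx.2⟩]
  have ha0 : ∀ w, 0 ≤ a w := density_nonneg fun _ => abs_nonneg _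
  refine ⟨fun w => |T w| + 3 * a w, fun w => add_nonneg (abs_nonneg _)
    (mul_nonneg (by norm_num) (ha0 w)), fun w => ?_, fun n => ?_, fun x hx r hr => ?_⟩
  · have hsum : ∑ i, T (w ++ [i]) = 3 * T w := by
      simp only [hTs, Fin.sum_univ_three]
      simp only [Fin.isValue, zero_add, show (1 : Fin 3) + 1 = 2 from rfl,
        show (1 : Fin 3) + 2 = 0 from rfl, show (2 : Fin 3) + 1 = 0 from rfl,
        show (2 : Fin 3) + 2 = 1 from rfl]
      ring
    have habs := Finset.abs_sum_le_sum_abs (fun i => T (w ++ [i])) Finset.univ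
    rw [hsum, abs_mul, abs_of_pos (by norm_num : (0 : ℝ) < 3)] at habs
    rw [Finset.sum_add_distrib, ← Finset.mul_sum, ha, sum_density hlam hfi.abs]
    linarith
  · have h1 := sum_transform_sq_le T b s hT0 (sum_density hlam hfi) hs1 hTs n
    have h2 : ∑ w ∈ words n, b w ^ 2 ≤ ∑ w ∈ words n, a w ^ 2 :=
      Finset.sum_le_sum fun w _ => sq_le_sq' (neg_le_of_abs_le (abs_density_le w))
        (le_of_abs_le (abs_density_le w))
    have h3 : ∑ w ∈ words n, a w ^ 2 ≤ 3 ^ n * ∫ y, f y ^ 2 ∂gasketMeasure lam := by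
      rw [← sum_words_setIntegral hlam hf.integrable_sq n, Finset.mul_sum]
      refine Finset.sum_le_sum fun w hw => ?_
      rw [← mem_words.1 hw]
      exact sq_density_abs_le hlam hf w
    -- By `h1` and `h2` the right-hand side is at most `2 / 3 + 18 ≤ 19` times `∑ a w ^ 2`.
    have h4 : ∑ w ∈ words n, (|T w| + 3 * a w) ^ 2 ≤
        2 * ∑ w ∈ words n, T w ^ 2 + 18 * ∑ w ∈ words n, a w ^ 2 := by
      rw [Finset.mul_sum, Finset.mul_sum, ← Finset.sum_add_distrib]
      refine Finset.sum_le_sum fun w _ => ?_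
      nlinarith [sq_nonneg (|T w| - 3 * a w), sq_abs (T w)]
    have h5 : 0 ≤ ∑ w ∈ words n, a w ^ 2 := Finset.sum_nonneg fun w _ => sq_nonneg _
    linarith
  · obtain ⟨w, hw, hle⟩ := exists_abs_truncated_le hlam he hOm hh hfi hx hr
    rw [hT w x ⟨hx, hw⟩] at hle
    exact ⟨w, hw, hle⟩

/-! ### Measurability of the maximal function -/

lemma integrableOn_truncated (hlam : lam ∈ Ioo (0 : ℝ) (1 / 3)) (he : IsAdmissibleAngle lam e)
    (hOm : IsAngularPart e Om) (hh : IsRadialPart lam h)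
    (hf : Integrable f (gasketMeasure lam)) {x : Plane} (hx : x ∈ gasket lam) {r : ℝ}
    (hr : 0 < r) :
    IntegrableOn (fun y => kernel Om h x y * f y) {y | r < ‖x - y‖} (gasketMeasure lam) := by
  obtain ⟨n, hn⟩ := exists_pow_lt_of_lt_one hr (by linarith [hlam.2] : lam < 1)
  exact integrableOn_kernel_mul hlam he hOm hh hf hx
    (measurableSet_lt measurable_const (by fun_prop)) fun y hy _ => hn.trans hy

lemma aemeasurable_truncated (hlam : lam ∈ Ioo (0 : ℝ) (1 / 3))
    (hOm : IsAngularPart e Om) (hh : IsRadialPart lam h)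
    (hf : AEStronglyMeasurable f (gasketMeasure lam)) {r : ℝ} (hr : 0 < r) :
    AEMeasurable (truncated lam Om h r f) (gasketMeasure lam) := by
  have := isFiniteMeasure_gasketMeasure hlam
  have hR : MeasurableSet {p : Plane × Plane | r < ‖p.1 - p.2‖} :=
    measurableSet_lt measurable_const (by fun_prop)
  set G : Plane × Plane → ℝ := {p : Plane × Plane | r < ‖p.1 - p.2‖}.indicator fun p =>
    {p : Plane × Plane | p.1 ≠ p.2}.indicator (fun p => kernel Om h p.1 p.2) p * hf.mk f p.2 with hG
  have hGm : StronglyMeasurable G :=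
    (((measurable_kernel hOm hh).mul
      (hf.stronglyMeasurable_mk.measurable.comp measurable_snd)).indicator hR).stronglyMeasurable
  have key : truncated lam Om h r f = fun x => ∫ y, G (x, y) ∂gasketMeasure lam := by
    ext x
    rw [truncated, ← integral_indicator (measurableSet_lt measurable_const (by fun_prop))]
    refine integral_congr_ae ?_
    filter_upwards [hf.ae_eq_mk] with y hy
    by_cases hry : r < ‖x - y‖
    · have hxy : x ≠ y := by
        rintro rfl
        rw [sub_self, norm_zero] at hry
        exact lt_asymm hr hry
      simp [hG, indicator, hry, hxy, ← hy]
    · simp [hG, indicator, hry]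
  rw [key]
  exact hGm.integral_prod_right'.measurable.aemeasurable

/-- The truncated integrals are right continuous in the truncation radius, so the supremum may be
taken over rational radii. -/
lemma maximal_eq_iSup_rat (hlam : lam ∈ Ioo (0 : ℝ) (1 / 3)) (he : IsAdmissibleAngle lam e)
    (hOm : IsAngularPart e Om) (hh : IsRadialPart lam h)
    (hf : Integrable f (gasketMeasure lam)) {x : Plane} (hx : x ∈ gasket lam) :
    maximal lam Om h f x =
      ⨆ (q : ℚ) (_ : (0 : ℝ) < q), ENNReal.ofReal |truncated lam Om h q f x| := by
  refine le_antisymm (iSup₂_le fun r hr => ?_) (iSup₂_le fun q hq =>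
    le_iSup₂ (f := fun (r : ℝ) (_ : 0 < r) => ENNReal.ofReal |truncated lam Om h r f x|) _ hq)
  obtain ⟨u, hu, hur, hlim⟩ := Real.exists_seq_rat_strictAnti_tendsto r
  have hset : ⋃ n, {y : Plane | (u n : ℝ) < ‖x - y‖} = {y | r < ‖x - y‖} := by
    ext y
    simp only [mem_iUnion, mem_ofPred_eq]
    refine ⟨fun ⟨n, hn⟩ => (hur n).trans hn, fun hy => ?_⟩
    exact (hlim.eventually_lt_const hy).exists
  have htend : Filter.Tendsto (fun n => truncated lam Om h (u n) f x) Filter.atTop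
      (nhds (truncated lam Om h r f x)) := by
    unfold truncated
    rw [← hset]
    refine tendsto_setIntegral_of_monotone
      (fun n => measurableSet_lt measurable_const (by fun_prop)) ?_ ?_
    · intro m n hmn y hy
      have : (u n : ℝ) ≤ u m := by exact_mod_cast hu.antitone hmn
      exact this.trans_lt hy
    · rw [hset]
      exact integrableOn_truncated hlam he hOm hh hf hx hr
  refine le_of_tendsto ((ENNReal.continuous_ofReal.tendsto _).comp htend.abs)
    (Filter.Eventually.of_forall fun n => ?_)
  exact le_iSup₂ (f := fun (q : ℚ) (_ : (0 : ℝ) < q) =>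
    ENNReal.ofReal |truncated lam Om h q f x|) (u n) (hr.trans (hur n))

lemma aemeasurable_maximal (hlam : lam ∈ Ioo (0 : ℝ) (1 / 3)) (he : IsAdmissibleAngle lam e)
    (hOm : IsAngularPart e Om) (hh : IsRadialPart lam h)
    (hf : Integrable f (gasketMeasure lam)) :
    AEMeasurable (maximal lam Om h f) (gasketMeasure lam) := by
  have h1 : AEMeasurable (fun x => ⨆ (q : ℚ) (_ : (0 : ℝ) < q),
      ENNReal.ofReal |truncated lam Om h q f x|) (gasketMeasure lam) := by
    refine AEMeasurable.iSup fun q => AEMeasurable.iSup fun hq => ?_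
    exact (aemeasurable_truncated hlam hOm hh hf.aestronglyMeasurable hq).abs.ennreal_ofReal
  refine h1.congr ?_
  filter_upwards [ae_mem_gasket] with x hx
  exact (maximal_eq_iSup_rat hlam he hOm hh hf hx).symm

/-! ### The maximal inequality -/

/-- The `L²` bound for the maximal function of a nonnegative submartingale on the ternary tree,
transferred to the gasket. -/
lemma lintegral_iSup_sq_le (hlam : lam ∈ Ioo (0 : ℝ) (1 / 3)) {F : List (Fin 3) → ℝ}
    (h0 : ∀ w, 0 ≤ F w) (hF : ∀ w, 3 * F w ≤ ∑ i, F (w ++ [i])) {A : ℝ}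
    (hA : ∀ n, ∑ w ∈ words n, F w ^ 2 ≤ 3 ^ n * A) {g : Plane → ℝ≥0∞}
    (hg : ∀ x ∈ gasket lam,
      g x ≤ ⨆ (w : List (Fin 3)) (_ : x ∈ triangle lam w), ENNReal.ofReal (F w)) :
    ∫⁻ x, g x ^ 2 ∂gasketMeasure lam ≤ ENNReal.ofReal (4 * A) := by
  set M := prefixMax F with hM
  have hFM : ∀ w, F w ≤ M w := le_prefixMax F
  have hMi : ∀ w i, M w ≤ M (w ++ [i]) := fun w i => by
    rw [hM, prefixMax_append]
    exact le_max_left _ _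
  set step : ℕ → Plane → ℝ≥0∞ := fun n x =>
    ∑ w ∈ words n, (triangle lam w).indicator (fun _ => ENNReal.ofReal (M w ^ 2)) x with hstep
  have hmeas : ∀ n, Measurable (step n) := fun n =>
    Finset.measurable_fun_sum _ fun w _ => measurable_const.indicator (measurableSet_triangle w)
  have heval : ∀ w, ∀ x ∈ triangle lam w, step w.length x = ENNReal.ofReal (M w ^ 2) := by
    intro w x hx
    rw [hstep]
    simp only
    rw [Finset.sum_eq_single_of_mem w (mem_words.2 rfl), indicator_of_mem hx]
    intro v hv hvw
    exact indicator_of_notMem (fun hxv => hvw (eq_of_mem_triangle hlam (mem_words.1 hv) hxv hx)) _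
  have hmono : ∀ x ∈ gasket lam, Monotone fun n => step n x := by
    intro x hx
    refine monotone_nat_of_le_succ fun n => ?_
    obtain ⟨w, rfl, hw⟩ := mem_gasket.1 hx n
    obtain ⟨i, hi⟩ := exists_mem_child hlam hx hw
    have e := heval (w ++ [i]) x hi
    rw [List.length_append, List.length_singleton] at e
    rw [heval w x hw, e]
    exact ENNReal.ofReal_le_ofReal
      (pow_le_pow_left₀ ((h0 w).trans (hFM w)) (hMi w i) 2)
  have hint : ∀ n, ∫⁻ x, step n x ∂gasketMeasure lam ≤ ENNReal.ofReal (4 * A) := by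
    intro n
    rw [hstep, lintegral_finsetSum _ fun w _ =>
      measurable_const.indicator (measurableSet_triangle w)]
    have hle : ∀ w ∈ words n, ∫⁻ x, (triangle lam w).indicator
        (fun _ => ENNReal.ofReal (M w ^ 2)) x ∂gasketMeasure lam ≤
        ENNReal.ofReal (M w ^ 2 * (3⁻¹ : ℝ) ^ n) := by
      intro w hw
      rw [lintegral_indicator_const (measurableSet_triangle w), gasketMeasure_triangle hlam,
        mem_words.1 hw, ENNReal.ofReal_mul (sq_nonneg _), gasketMeasure,
        Measure.restrict_apply_univ]
      gcongr
      exact mul_le_of_le_one_right' (hausdorffMeasure_gasket_le_one hlam)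
    refine (Finset.sum_le_sum hle).trans ?_
    rw [← ENNReal.ofReal_sum_of_nonneg fun w _ => by positivity, ← Finset.sum_mul]
    refine ENNReal.ofReal_le_ofReal ?_
    have h4 : ∑ w ∈ words n, M w ^ 2 ≤ 4 * (3 ^ n * A) :=
      (sum_prefixMax_sq_le F h0 hF n).trans (mul_le_mul_of_nonneg_left (hA n) (by norm_num))
    refine (mul_le_mul_of_nonneg_right h4 (by positivity)).trans (le_of_eq ?_)
    rw [inv_pow]
    field_simp
  have hle : ∀ x ∈ gasket lam, g x ^ 2 ≤ ⨆ n, step n x := by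
    intro x hx
    refine (pow_le_pow_left₀ zero_le (hg x hx) 2).trans ?_
    rw [ENNReal.iSup_pow_of_ne_zero two_ne_zero]
    refine iSup_le fun w => ?_
    rw [ENNReal.iSup_pow_of_ne_zero two_ne_zero]
    refine iSup_le fun hw => ?_
    rw [← ENNReal.ofReal_pow (h0 w)]
    refine le_trans ?_ (le_iSup (fun n => step n x) w.length)
    rw [heval w x hw]
    exact ENNReal.ofReal_le_ofReal (pow_le_pow_left₀ (h0 w) (hFM w) 2)
  calc ∫⁻ x, g x ^ 2 ∂gasketMeasure lam
      ≤ ∫⁻ x, ⨆ n, step n x ∂gasketMeasure lam :=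
        lintegral_mono_ae (ae_mem_gasket.mono hle)
    _ = ⨆ n, ∫⁻ x, step n x ∂gasketMeasure lam :=
        lintegral_iSup' (fun n => (hmeas n).aemeasurable) (ae_mem_gasket.mono hmono)
    _ ≤ ENNReal.ofReal (4 * A) := iSup_le hint

end SierpinskiGasket

end

theorem theorem3p1 (lam : ℝ) (hlam : lam ∈ Set.Ioo (0 : ℝ) (1 / 3))
    (e : ℝ) (he : SierpinskiGasket.IsAdmissibleAngle lam e)
    (Om : SierpinskiGasket.Plane → ℝ) (hOm : SierpinskiGasket.IsAngularPart e Om)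
    (h : ℝ → ℝ) (hh : SierpinskiGasket.IsRadialPart lam h) :
    ∃ C : NNReal, ∀ f : SierpinskiGasket.Plane → ℝ,
      MeasureTheory.MemLp f 2 (SierpinskiGasket.gasketMeasure lam) →
        (∀ x ∈ SierpinskiGasket.gasket lam, ∀ r : ℝ, 0 < r →
          MeasureTheory.IntegrableOn (fun y => SierpinskiGasket.kernel Om h x y * f y)
            {y | r < ‖x - y‖} (SierpinskiGasket.gasketMeasure lam)) ∧
        AEMeasurable (SierpinskiGasket.maximal lam Om h f)
          (SierpinskiGasket.gasketMeasure lam) ∧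
        ∫⁻ x, (SierpinskiGasket.maximal lam Om h f x) ^ 2 ∂(SierpinskiGasket.gasketMeasure lam) ≤
          (C : ENNReal) *
            ∫⁻ x, ENNReal.ofReal (|f x| ^ 2) ∂(SierpinskiGasket.gasketMeasure lam) := by
  have := SierpinskiGasket.isFiniteMeasure_gasketMeasure hlam
  -- `76 = 4 * 19`: Doob's constant times the `L²` bound of the dominating submartingale.
  refine ⟨76, fun f hf => ?_⟩
  have hfi : Integrable f (SierpinskiGasket.gasketMeasure lam) := hf.integrable one_le_two
  refine ⟨fun x hx r hr => SierpinskiGasket.integrableOn_truncated hlam he hOm hh hfi hx hr,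
    SierpinskiGasket.aemeasurable_maximal hlam he hOm hh hfi, ?_⟩
  obtain ⟨F, h0, hF, hsum, hdom⟩ := SierpinskiGasket.exists_submartingale hlam he hOm hh hf
  refine (SierpinskiGasket.lintegral_iSup_sq_le hlam h0 hF
    (A := 19 * ∫ y, f y ^ 2 ∂SierpinskiGasket.gasketMeasure lam)
    (fun n => (hsum n).trans (le_of_eq (by ring))) fun x hx => ?_).trans (le_of_eq ?_)
  · refine iSup₂_le fun r hr => ?_
    obtain ⟨w, hw, hle⟩ := hdom x hx r hr
    exact (ENNReal.ofReal_le_ofReal hle).trans (le_iSup₂ (f := fun (w : List (Fin 3))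
      (_ : x ∈ SierpinskiGasket.triangle lam w) => ENNReal.ofReal (F w)) w hw)
  · simp only [sq_abs]
    rw [← mul_assoc, ENNReal.ofReal_mul (by norm_num),
      ofReal_integral_eq_lintegral_ofReal hf.integrable_sq
        (Filter.Eventually.of_forall fun y => sq_nonneg _)]
    norm_num
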